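/- **Setting.** Let $R$ be a commutative ring with identity and let $W\subseteq R$ be a multiplicatively closed set containing $1$. A *class* $\mathcal M$ of $R$-modules means an isomorphism-invariant class closed under submodules and quotient modules. A *submodule selector* $\alpha$ on an isomorphism-invariant class $\mathcal M$ assigns to each $M\in\mathcal M$ a submodule $\alpha(M)\subseteq M$ with $\varphi(\alpha(M))=\alpha(N)$ for every isomorphism $\varphi:M\to N$ in $\mathcal M$. We write $\alpha\le\beta$ if $\alpha(M)\subseteq\beta(M)$ for all $M\in\mathcal M$. Further, $\alpha$ is *idempotent* if $\alpha(\alpha(M))=\alpha(M)$ for all $M$, *co-idempotent* if $\alpha(M/\alpha(M))=0$ for all $M$, and *functorial* if $g(\alpha(M))\subseteq\alpha(N)$ for every $R$-linear map $g:M\to N$ in $\mathcal M$. For a directed system $(s_j)_j$ of submodule selectors, meaning that $s_i\le s_j$ for $i\le j$ in a directed index set, $(\varinjlim_j s_j)(M):=\bigcup_j s_j(M)$. For $R$-modules $L,M$ put $\operatorname{tr}_L(M):=\sum_{f\in\operatorname{Hom}_R(L,M)}f(L)$. An $R$-module $M$ is *$W$-torsion free* (resp. *$W$-divisible*) if multiplication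 by each $w\in W$ on $M$ is injective (resp. surjective), and *$h_W$-divisible* if there is a surjective $R$-linear map onto $M$ from a free $W^{-1}R$-module. Let $\operatorname{tor}_W(M):=\ker(M\to W^{-1}M)$, and let $\operatorname{dv}_W(M)$ be the sum of all $W$-divisible submodules of $M$. Then $\operatorname{tr}_L$, $\operatorname{tor}_W$ and $\operatorname{dv}_W$ are submodule selectors. If $R$ is a complete Noetherian local ring with residue field $k$, let $E$ be an injective hull of $k$ and $M^\vee:=\operatorname{Hom}_R(M,E)$. A module $M$ is *Matlis-dualizable* if $M^{\vee\vee}\cong M$. For a class $\mathcal M$ of Matlis-dualizable modules, $\mathcal M^\vee$ denotes the class of all modules isomorphic to $N^\vee$ for some $N\in\mathcal M$. The *smile dual* of a submodule selector $\alpha$ on $\mathcal M$ is the submodule selector $\alpha^\smallsmile$ on $\mathcal M^\vee$ given by $\alpha^\smallsmile(M):=(M^\vee/\alpha(M^\vee))^\vee$, regarded as a submodule of $M$ via the evaluation map $M\to M^{\vee\vee}$. **Proposition 9.3.** 1. An $R$-module $M$ is $W$-torsion free if and only if $\operatorname{tor}_W(M)=0$. 2. An $R$-module $M$ is $W$-divisible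 if and only if $\operatorname{dv}_W(M)=M$. 3. An $R$-module $M$ is $h_W$-divisible if and only if $\operatorname{tr}_{W^{-1}R}(M)=M$. 4. For every $R$-module $M$, $\operatorname{tr}_{W^{-1}R}(M)\subseteq\operatorname{dv}_W(M)$; that is, $\operatorname{tr}_{W^{-1}R}\le\operatorname{dv}_W$ on every class of modules. 5. On every class of modules, the selectors $\operatorname{tr}_{R/(w)}$, $w\in W$, form a directed system, where $W$ is directed by divisibility in $R$, and $\operatorname{tor}_W=\varinjlim_{w\in W}\operatorname{tr}_{R/(w)}$. 6. On every class of modules, $\operatorname{dv}_W$ is idempotent and functorial. 7. On every class of modules, $\operatorname{tor}_W$ is idempotent, functorial and co-idempotent. If moreover $R$ is a complete Noetherian local ring, then: 8. $\operatorname{dv}_W(M)=\operatorname{tr}_{W^{-1}R}(M)$ for every Matlis-dualizable $R$-module $M$. 9. For every class $\mathcal M$ of Matlis-dualizable modules, the smile dual of $\operatorname{dv}_W$ on $\mathcal M$ is $\operatorname{tor}_W$ on $\mathcal M^\vee$. Also $\operatorname{tor}_W(M)=(M^\vee/\operatorname{dv}_W(M^\vee))^\vee$, regarded as a submodule of $M$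 via the evaluation map, for every Matlis-dualizable $M$. 10. $\operatorname{dv}_W(M)=\bigcap_{w\in W}wM$ for every Matlis-dualizable $R$-module $M$. -/

import Mathlib

universe u

noncomputable section

namespace Selectors

/-! ### Classes of modules and submodule selectors -/

/-- A class of `R`-modules (living in the universe of `R`). -/
abbrev ModuleClass (R : Type u) [CommRing R] :=
  ∀ (M : Type u) [AddCommGroup M] [Module R M], Prop

/-- The class is closed under taking submodules and quotient modules; classes of modules are
understood to be invariant under isomorphism. -/
structure ModuleClass.IsClosed {R : Type u} [CommRing R] (P : ModuleClass R) : Prop where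
  submodule : ∀ {M : Type u} [AddCommGroup M] [Module R M] (L : Submodule R M), P M → P L
  quotient : ∀ {M : Type u} [AddCommGroup M] [Module R M] (L : Submodule R M), P M → P (M ⧸ L)
  equiv : ∀ {M N : Type u} [AddCommGroup M] [Module R M] [AddCommGroup N] [Module R N],
    (M ≃ₗ[R] N) → P M → P N

/-- A submodule selector on the class `P`: a choice of a submodule `α(M) ⊆ M` for each `M` in `P`,
compatible with isomorphisms. -/
@[ext]
structure SubmoduleSelector {R : Type u} [CommRing R] (P : ModuleClass R) where
  sel : ∀ (M : Type u) [AddCommGroup M] [Module R M], P M → Submodule R M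
  map_equiv : ∀ {M N : Type u} [AddCommGroup M] [Module R M] [AddCommGroup N] [Module R N]
    (hM : P M) (hN : P N) (e : M ≃ₗ[R] N), (sel M hM).map (e : M →ₗ[R] N) = sel N hN

namespace SubmoduleSelector

variable {R : Type u} [CommRing R] {P : ModuleClass R}

/-- `α ≤ β` if `α(M) ⊆ β(M)` for all `M` in the class. -/
instance : PartialOrder (SubmoduleSelector P) where
  le α β := ∀ (M : Type u) [AddCommGroup M] [Module R M] (hM : P M), α.sel M hM ≤ β.sel M hM
  le_refl α M _ _ hM := le_rfl
  le_trans α β γ h₁ h₂ M _ _ hM := (h₁ M hM).trans (h₂ M hM)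
  le_antisymm α β h₁ h₂ := by
    ext M _ _ hM x
    exact ⟨fun h => h₁ M hM h, fun h => h₂ M hM h⟩

/-- `g(α(M)) ⊆ α(N)` for every `R`-linear map `g : M → N` between modules of the class. -/
def IsFunctorial (α : SubmoduleSelector P) : Prop :=
  ∀ {M N : Type u} [AddCommGroup M] [Module R M] [AddCommGroup N] [Module R N]
    (hM : P M) (hN : P N) (g : M →ₗ[R] N), (α.sel M hM).map g ≤ α.sel N hN

/-- `α(α(M)) = α(M)`, as submodules of `M`. -/
def IsIdempotent (hP : P.IsClosed) (α : SubmoduleSelector P) : Prop :=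
  ∀ (M : Type u) [AddCommGroup M] [Module R M] (hM : P M),
    (α.sel (α.sel M hM) (hP.submodule _ hM)).map (α.sel M hM).subtype = α.sel M hM

/-- `α(M / α(M)) = 0`. -/
def IsCoidempotent (hP : P.IsClosed) (α : SubmoduleSelector P) : Prop :=
  ∀ (M : Type u) [AddCommGroup M] [Module R M] (hM : P M),
    α.sel (M ⧸ α.sel M hM) (hP.quotient _ hM) = ⊥

/-- The direct limit of a directed system of submodule selectors: `M ↦ ⋃ j, s j (M)`. -/
def dirLim {Γ : Type u} [Preorder Γ] [IsDirected Γ (· ≤ ·)] [Nonempty Γ]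
    (s : Γ → SubmoduleSelector P) (hs : Monotone s) : SubmoduleSelector P where
  sel M _ _ hM :=
    { carrier := ⋃ j, ((s j).sel M hM : Set M)
      zero_mem' := Set.mem_iUnion.2 ⟨Classical.arbitrary Γ, zero_mem _⟩
      add_mem' := by
        intro a b ha hb
        obtain ⟨i, hi⟩ := Set.mem_iUnion.1 ha
        obtain ⟨j, hj⟩ := Set.mem_iUnion.1 hb
        obtain ⟨k, hik, hjk⟩ := exists_ge_ge i j
        exact Set.mem_iUnion.2 ⟨k, add_mem (hs hik M hM hi) (hs hjk M hM hj)⟩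
      smul_mem' := by
        intro c a ha
        obtain ⟨i, hi⟩ := Set.mem_iUnion.1 ha
        exact Set.mem_iUnion.2 ⟨i, Submodule.smul_mem _ c hi⟩ }
  map_equiv := by
    intro M N _ _ _ _ hM hN e
    apply SetLike.coe_injective
    rw [Submodule.map_coe]
    change (⇑(e : M →ₗ[R] N)) '' (⋃ j, ((s j).sel M hM : Set M)) = ⋃ j, ((s j).sel N hN : Set N)
    rw [Set.image_iUnion]
    refine Set.iUnion_congr fun j => ?_
    rw [← (s j).map_equiv hM hN e, Submodule.map_coe]

end SubmoduleSelector

/-! ### Traces, torsion and divisibility -/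

section Rules

variable (R : Type u) [CommRing R] (W : Submonoid R)

/-- The `L`-trace of `M`: the sum of the images `f(L)` over all `R`-linear maps `f : L → M`. -/
def trace (L M : Type u) [AddCommGroup L] [Module R L] [AddCommGroup M] [Module R M] :
    Submodule R M :=
  ⨆ f : L →ₗ[R] M, LinearMap.range f

variable {R}

/-- `M` is `W`-torsion free: every `w ∈ W` acts injectively. -/
def IsTorsionFreeFor (M : Type u) [AddCommGroup M] [Module R M] : Prop :=
  ∀ w ∈ W, Function.Injective fun z : M => w • z

/-- `M` is `W`-divisible: every `w ∈ W` acts surjectively. -/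
def IsDivisibleFor (M : Type u) [AddCommGroup M] [Module R M] : Prop :=
  ∀ w ∈ W, Function.Surjective fun z : M => w • z

/-- `M` is `h_W`-divisible: it is an `R`-linear quotient of a free `W⁻¹R`-module. -/
def IsHDivisibleFor (M : Type u) [AddCommGroup M] [Module R M] : Prop :=
  ∃ (N : Type u) (_ : AddCommGroup N) (_ : Module R N) (_ : Module (Localization W) N)
    (_ : IsScalarTower R (Localization W) N),
    Module.Free (Localization W) N ∧ ∃ f : N →ₗ[R] M, Function.Surjective f

/-- The `W`-torsion submodule: the kernel of the localization map `M → W⁻¹M`. -/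
def torsion (M : Type u) [AddCommGroup M] [Module R M] : Submodule R M :=
  LinearMap.ker (LocalizedModule.mkLinearMap W M)

/-- The sum of all `W`-divisible submodules of `M`. -/
def divisible (M : Type u) [AddCommGroup M] [Module R M] : Submodule R M :=
  sSup {L : Submodule R M | IsDivisibleFor W L}

theorem map_trace_le (L : Type u) [AddCommGroup L] [Module R L] {M N : Type u}
    [AddCommGroup M] [Module R M] [AddCommGroup N] [Module R N] (g : M →ₗ[R] N) :
    (trace R L M).map g ≤ trace R L N := by
  rw [trace, Submodule.map_iSup]
  refine iSup_le fun f => ?_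
  rw [← LinearMap.range_comp]
  exact le_iSup (fun f : L →ₗ[R] N => LinearMap.range f) (g ∘ₗ f)

theorem map_torsion_le {M N : Type u}
    [AddCommGroup M] [Module R M] [AddCommGroup N] [Module R N] (g : M →ₗ[R] N) :
    (torsion W M).map g ≤ torsion W N := by
  rintro _ ⟨z, hz, rfl⟩
  have hz' : LocalizedModule.mkLinearMap W M z = 0 := hz
  change LocalizedModule.mkLinearMap W N (g z) = 0
  rw [← IsLocalizedModule.map_apply W (LocalizedModule.mkLinearMap W M)
    (LocalizedModule.mkLinearMap W N) g z, hz', map_zero]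

theorem map_divisible_le {M N : Type u}
    [AddCommGroup M] [Module R M] [AddCommGroup N] [Module R N] (g : M →ₗ[R] N) :
    (divisible W M).map g ≤ divisible W N := by
  rw [Submodule.map_le_iff_le_comap]
  refine sSup_le fun L hL => ?_
  rw [← Submodule.map_le_iff_le_comap]
  refine le_sSup ?_
  rintro w hw ⟨_, x, hx, rfl⟩
  obtain ⟨y, hy⟩ := hL w hw ⟨x, hx⟩
  refine ⟨⟨g y, y, y.2, rfl⟩, Subtype.ext ?_⟩
  have hy' : w • (y : M) = x := congrArg Subtype.val hy
  change w • g y = g x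
  rw [← hy', map_smul]

theorem map_equiv_of_map_le {M N : Type u}
    [AddCommGroup M] [Module R M] [AddCommGroup N] [Module R N] (A : Submodule R M)
    (B : Submodule R N) (e : M ≃ₗ[R] N) (h₁ : A.map (e : M →ₗ[R] N) ≤ B)
    (h₂ : B.map (e.symm : N →ₗ[R] M) ≤ A) : A.map (e : M →ₗ[R] N) = B := by
  refine le_antisymm h₁ fun y hy => ?_
  exact ⟨e.symm y, h₂ ⟨y, hy, rfl⟩, e.apply_symm_apply y⟩

/-- The trace `tr_L` as a submodule selector on `P`. -/
def traceSelector (P : ModuleClass R) (L : Type u) [AddCommGroup L] [Module R L] :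
    SubmoduleSelector P where
  sel M _ _ _ := trace R L M
  map_equiv _ _ e := map_equiv_of_map_le _ _ e (map_trace_le L _) (map_trace_le L _)

/-- The `W`-torsion submodule selector on `P`. -/
def torsionSelector (P : ModuleClass R) : SubmoduleSelector P where
  sel M _ _ _ := torsion W M
  map_equiv _ _ e := map_equiv_of_map_le _ _ e (map_torsion_le W _) (map_torsion_le W _)

/-- The `W`-divisible submodule selector on `P`. -/
def divisibleSelector (P : ModuleClass R) : SubmoduleSelector P where
  sel M _ _ _ := divisible W M
  map_equiv _ _ e := map_equiv_of_map_le _ _ e (map_divisible_le W _) (map_divisible_le W _)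

/-- The set `W`, directed by divisibility in `R`. -/
structure DivIndex where
  val : R
  mem : val ∈ W

instance : Preorder (DivIndex W) where
  le v w := v.val ∣ w.val
  le_refl v := dvd_refl v.val
  le_trans _ _ _ h₁ h₂ := dvd_trans h₁ h₂

instance : Nonempty (DivIndex W) := ⟨⟨1, W.one_mem⟩⟩

instance : IsDirected (DivIndex W) (· ≤ ·) :=
  ⟨fun v w => ⟨⟨v.val * w.val, W.mul_mem v.mem w.mem⟩, Dvd.intro _ rfl, Dvd.intro_left _ rfl⟩⟩

end Rules

/-! ### Matlis duality and the smile dual -/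

section Duality

variable {R : Type u} [CommRing R]

/-- `ι : N → E` exhibits `E` as an injective hull of `N`: `E` is injective and `ι` is an injective
map whose image is essential in `E`. -/
structure IsInjectiveHull {N E : Type u} [AddCommGroup N] [Module R N] [AddCommGroup E]
    [Module R E] (ι : N →ₗ[R] E) : Prop where
  injective_module : Module.Injective R E
  injective : Function.Injective ι
  essential : ∀ L : Submodule R E, L ⊓ LinearMap.range ι = ⊥ → L = ⊥

variable (R) (E : Type u) [AddCommGroup E] [Module R E]

/-- The dual `M^∨ = Hom_R(M, E)`. -/
abbrev Dual (M : Type u) [AddCommGroup M] [Module R M] : Type u := M →ₗ[R] E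

/-- The evaluation map `M → M^∨∨`, `z ↦ (g ↦ g z)`. -/
def evalMap (M : Type u) [AddCommGroup M] [Module R M] : M →ₗ[R] Dual R E (Dual R E M) :=
  LinearMap.flip LinearMap.id

/-- `M` is Matlis-dualizable: `M^∨∨ ≅ M`. In particular this holds when the evaluation map
`M → M^∨∨` is bijective. -/
def IsDualizable (M : Type u) [AddCommGroup M] [Module R M] : Prop :=
  Nonempty (Dual R E (Dual R E M) ≃ₗ[R] M)

/-- The class `P^∨` of all modules isomorphic to `N^∨` for some `N` in `P`. -/
def dualClass {R : Type u} [CommRing R] (E : Type u) [AddCommGroup E] [Module R E]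
    (P : ModuleClass R) : ModuleClass R := fun M _ _ =>
  ∃ (N : Type u) (_ : AddCommGroup N) (_ : Module R N), P N ∧ Nonempty (M ≃ₗ[R] Dual R E N)

/-- For `A ⊆ M^∨`, the dual `(M^∨ / A)^∨`, embedded in `M^∨∨` by composition with
`M^∨ → M^∨ / A` and viewed as a submodule of `M` through the evaluation map `M → M^∨∨`. -/
def dualQuotient (M : Type u) [AddCommGroup M] [Module R M] (A : Submodule R (Dual R E M)) :
    Submodule R M :=
  (LinearMap.range (LinearMap.lcomp R E A.mkQ :
    Dual R E (Dual R E M ⧸ A) →ₗ[R] Dual R E (Dual R E M))).comap (evalMap R E M)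

variable {R}

theorem mem_dualQuotient {M : Type u} [AddCommGroup M] [Module R M] (A : Submodule R (Dual R E M))
    (z : M) : z ∈ dualQuotient R E M A ↔ ∀ g ∈ A, g z = 0 := by
  constructor
  · rintro ⟨φ, hφ⟩ g hg
    have h : φ (A.mkQ g) = g z := LinearMap.congr_fun hφ g
    rw [← h, Submodule.mkQ_apply, (Submodule.Quotient.mk_eq_zero A).2 hg, map_zero]
  · intro h
    exact ⟨A.liftQ (evalMap R E M z) fun g hg => h g hg, LinearMap.ext fun _ => rfl⟩

variable {E} in
theorem dual_mem_of_mem_dualClass {P : ModuleClass R} (hP : P.IsClosed)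
    (hD : ∀ (M : Type u) [AddCommGroup M] [Module R M], P M → IsDualizable R E M)
    {M : Type u} [AddCommGroup M] [Module R M] (hM : dualClass E P M) : P (Dual R E M) := by
  obtain ⟨N, _, _, hN, ⟨e⟩⟩ := hM
  obtain ⟨d⟩ := hD N hN
  exact hP.equiv (d.symm.trans (e.congrLeft E R).symm) hN

/-- The smile dual of a submodule selector `α` on a class `P` of Matlis-dualizable modules: the
submodule selector `M ↦ (M^∨ / α(M^∨))^∨ ⊆ M` on `P^∨`. -/
def SubmoduleSelector.smile {P : ModuleClass R} (hP : P.IsClosed)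
    (hD : ∀ (M : Type u) [AddCommGroup M] [Module R M], P M → IsDualizable R E M)
    (α : SubmoduleSelector P) : SubmoduleSelector (dualClass E P) where
  sel M _ _ hM := dualQuotient R E M (α.sel (Dual R E M) (dual_mem_of_mem_dualClass hP hD hM))
  map_equiv := by
    have key : ∀ {M N : Type u} [AddCommGroup M] [Module R M] [AddCommGroup N] [Module R N]
        (hM : dualClass E P M) (hN : dualClass E P N) (e : M ≃ₗ[R] N),
        (dualQuotient R E M (α.sel (Dual R E M) (dual_mem_of_mem_dualClass hP hD hM))).map
          (e : M →ₗ[R] N) ≤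
        dualQuotient R E N (α.sel (Dual R E N) (dual_mem_of_mem_dualClass hP hD hN)) := by
      rintro M N _ _ _ _ hM hN e _ ⟨z, hz, rfl⟩
      have hz' := (mem_dualQuotient E _ z).1 hz
      refine (mem_dualQuotient E _ _).2 fun g hg => ?_
      refine hz' (g ∘ₗ (e : M →ₗ[R] N)) ?_
      rw [← α.map_equiv (dual_mem_of_mem_dualClass hP hD hN)
        (dual_mem_of_mem_dualClass hP hD hM) (e.symm.congrLeft E R)]
      exact ⟨g, hg, rfl⟩
    intro M N _ _ _ _ hM hN e
    exact map_equiv_of_map_le _ _ e (key hM hN e) (key hN hM e.symm)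

end Duality

end Selectors

end

namespace Selectors

/-! ### Torsion, divisibility and traces over an arbitrary commutative ring -/

section Rules

variable {R : Type u} [CommRing R] (W : Submonoid R)

/-! Torsion is settled elementwise: `z` is torsion iff some `w ∈ W` kills it, while `tr_{R/(w)}` is
exactly the set killed by `w`. A sum of divisible submodules is divisible, so `dv_W(M)` is the
largest one; it contains every image of the divisible module `W⁻¹R`.

For the local case, let `E` be injective. In a dual `N^∨` there is a cycle of inclusions `dv_W ⊆ ⋂ w
N^∨ ⊆ {g | g = 0 on tor_W(N)} ⊆ tr_{W⁻¹R} ⊆ dv_W`, so all four agree. The third inclusion is the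
crux (`mem_trace_localization_dual`). A dualizable `M` is isomorphic to the dual of `M^∨`, and the
equalities transport. The smile dual formula is a double annihilator: `dv_W(M^∨)` is the annihilator
of `tor_W(M)`, and since `E` is a cogenerator, what `dv_W(M^∨)` kills is `tor_W(M)` again. -/

theorem mem_torsion_iff {M : Type u} [AddCommGroup M] [Module R M] (z : M) :
    z ∈ torsion W M ↔ ∃ w ∈ W, w • z = 0 := by
  rw [torsion, LinearMap.mem_ker, IsLocalizedModule.eq_zero_iff W]
  exact ⟨fun ⟨c, hc⟩ => ⟨c, c.2, hc⟩, fun ⟨c, hc, h⟩ => ⟨⟨c, hc⟩, h⟩⟩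

theorem isTorsionFreeFor_iff (M : Type u) [AddCommGroup M] [Module R M] :
    IsTorsionFreeFor W M ↔ torsion W M = ⊥ := by
  constructor
  · refine fun h => (Submodule.eq_bot_iff _).2 fun z hz => ?_
    obtain ⟨w, hw, hz⟩ := (mem_torsion_iff W z).1 hz
    exact h w hw (by simpa using hz)
  · intro h w hw x y hxy
    have hxy' : w • x = w • y := hxy
    rw [← sub_eq_zero, ← Submodule.mem_bot R, ← h, mem_torsion_iff]
    exact ⟨w, hw, by rw [smul_sub, hxy', sub_self]⟩

theorem isDivisibleFor_divisible (M : Type u) [AddCommGroup M] [Module R M] :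
    IsDivisibleFor W (divisible W M) := by
  intro w hw
  -- Testing `dv ≤ w · dv` on one divisible `L = wL` at a time avoids writing elements as finite
  -- sums.
  have key : divisible W M ≤ (divisible W M).map (LinearMap.lsmul R M w) := by
    refine sSup_le fun L hL x hx => ?_
    obtain ⟨y, hy⟩ := hL w hw ⟨x, hx⟩
    exact ⟨y, le_sSup (a := L) hL y.2, congrArg Subtype.val hy⟩
  rintro ⟨x, hx⟩
  obtain ⟨y, hy, hxy⟩ := key hx
  exact ⟨⟨y, hy⟩, Subtype.ext hxy⟩

theorem isDivisibleFor_iff (M : Type u) [AddCommGroup M] [Module R M] :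
    IsDivisibleFor W M ↔ divisible W M = ⊤ := by
  constructor
  · refine fun h => top_le_iff.1 (le_sSup ?_)
    rintro w hw ⟨x, -⟩
    obtain ⟨y, hy⟩ := h w hw x
    exact ⟨⟨y, trivial⟩, Subtype.ext hy⟩
  · intro h w hw x
    obtain ⟨y, hy⟩ := isDivisibleFor_divisible W M w hw ⟨x, h ▸ Submodule.mem_top⟩
    exact ⟨y, congrArg Subtype.val hy⟩

theorem isDivisibleFor_localization : IsDivisibleFor W (Localization W) := by
  intro w hw x
  refine ⟨Localization.mk 1 ⟨w, hw⟩ * x, ?_⟩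
  change w • (Localization.mk 1 (⟨w, hw⟩ : W) * x) = x
  rw [← smul_mul_assoc, Localization.smul_mk, smul_eq_mul, mul_one,
    Localization.mk_self (⟨w, hw⟩ : W), one_mul]

theorem trace_localization_le_divisible (M : Type u) [AddCommGroup M] [Module R M] :
    trace R (Localization W) M ≤ divisible W M := by
  refine iSup_le fun f => ?_
  rw [LinearMap.range_eq_map,
    ← (isDivisibleFor_iff W _).1 (isDivisibleFor_localization W)]
  exact map_divisible_le W f

theorem isHDivisibleFor_iff (M : Type u) [AddCommGroup M] [Module R M] :
    IsHDivisibleFor W M ↔ trace R (Localization W) M = ⊤ := by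
  constructor
  · rintro ⟨N, _, _, _, _, -, f, hf⟩
    refine (Submodule.eq_top_iff'.2 fun z => ?_)
    obtain ⟨n, rfl⟩ := hf z
    refine le_iSup (fun g : Localization W →ₗ[R] M => LinearMap.range g)
      -- The map `a ↦ f (a • n)` sends `1` to `f n`.
      (f ∘ₗ (LinearMap.toSpanSingleton (Localization W) N n).restrictScalars R) ⟨1, ?_⟩
    simp
  · intro h
    -- One copy of `W⁻¹R` for each homomorphism to `M`; the image of the total map is the trace.
    refine ⟨(Localization W →ₗ[R] M) →₀ Localization W, inferInstance, inferInstance,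
      inferInstance, inferInstance, inferInstance,
      Finsupp.lsum R fun f : Localization W →ₗ[R] M => f, ?_⟩
    rw [← LinearMap.range_eq_top, ← top_le_iff, ← h]
    refine iSup_le fun f => ?_
    rintro _ ⟨x, rfl⟩
    exact ⟨Finsupp.single f x, by simp⟩

/-- A map out of `R/(w)` amounts to the image of `1`, which may be any element killed by `w`. -/
theorem mem_trace_quotient_span_singleton_iff (w : R) {M : Type u} [AddCommGroup M] [Module R M]
    (z : M) : z ∈ trace R (R ⧸ Ideal.span {w}) M ↔ w • z = 0 := by
  constructor
  · intro hz
    suffices h : trace R (R ⧸ Ideal.span {w}) M ≤ LinearMap.ker (LinearMap.lsmul R M w) from h hz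
    refine iSup_le fun f => ?_
    rintro _ ⟨x, rfl⟩
    obtain ⟨r, rfl⟩ := Ideal.Quotient.mk_surjective x
    rw [LinearMap.mem_ker, LinearMap.lsmul_apply, ← map_smul]
    have : w • Ideal.Quotient.mk (Ideal.span {w}) r = 0 :=
      Ideal.Quotient.eq_zero_iff_mem.2 (Ideal.mem_span_singleton.2 (Dvd.intro _ rfl))
    rw [this, map_zero]
  · intro hz
    have h : Ideal.span {w} ≤ LinearMap.ker (LinearMap.toSpanSingleton R M z) := by
      rw [Ideal.span_le, Set.singleton_subset_iff]
      simpa using hz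
    refine le_iSup (fun g : (R ⧸ Ideal.span {w}) →ₗ[R] M => LinearMap.range g)
      (Submodule.liftQ _ _ h) ⟨Submodule.Quotient.mk 1, ?_⟩
    rw [Submodule.liftQ_apply, LinearMap.toSpanSingleton_apply, one_smul]

theorem monotone_traceSelector_quotient (P : ModuleClass R) :
    Monotone fun w : DivIndex W => traceSelector P (R ⧸ Ideal.span {w.val}) := by
  intro v w hvw M _ _ _ z hz
  obtain ⟨c, hc⟩ : v.val ∣ w.val := hvw
  refine (mem_trace_quotient_span_singleton_iff w.val z).2 ?_
  rw [hc, mul_comm, mul_smul, (mem_trace_quotient_span_singleton_iff v.val z).1 hz, smul_zero]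

theorem torsionSelector_eq_dirLim (P : ModuleClass R) :
    torsionSelector W P =
      SubmoduleSelector.dirLim _ (monotone_traceSelector_quotient W P) := by
  ext M _ _ hM z
  refine (mem_torsion_iff W z).trans (Iff.trans ?_ Set.mem_iUnion.symm)
  constructor
  · rintro ⟨w, hw, hz⟩
    exact ⟨⟨w, hw⟩, (mem_trace_quotient_span_singleton_iff w z).2 hz⟩
  · rintro ⟨w, hw⟩
    exact ⟨w.val, w.mem, (mem_trace_quotient_span_singleton_iff w.val z).1 hw⟩

variable {P : ModuleClass R} (hP : P.IsClosed)

theorem divisibleSelector_isIdempotent : (divisibleSelector W P).IsIdempotent hP := by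
  intro M _ _ hM
  change (divisible W (divisible W M)).map (divisible W M).subtype = divisible W M
  rw [(isDivisibleFor_iff W _).1 (isDivisibleFor_divisible W M), Submodule.map_subtype_top]

theorem torsionSelector_isIdempotent : (torsionSelector W P).IsIdempotent hP := by
  intro M _ _ hM
  change (torsion W (torsion W M)).map (torsion W M).subtype = torsion W M
  have h : torsion W (torsion W M) = ⊤ := by
    refine Submodule.eq_top_iff'.2 fun z => ?_
    obtain ⟨w, hw, hz⟩ := (mem_torsion_iff W _).1 z.2
    exact (mem_torsion_iff W z).2 ⟨w, hw, Subtype.ext hz⟩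
  rw [h, Submodule.map_subtype_top]

theorem torsionSelector_isCoidempotent : (torsionSelector W P).IsCoidempotent hP := by
  intro M _ _ hM
  change torsion W (M ⧸ torsion W M) = ⊥
  refine (Submodule.eq_bot_iff _).2 fun z hz => ?_
  obtain ⟨x, rfl⟩ := Submodule.Quotient.mk_surjective _ z
  obtain ⟨w, hw, hx⟩ := (mem_torsion_iff W _).1 hz
  rw [← Submodule.Quotient.mk_smul, Submodule.Quotient.mk_eq_zero, mem_torsion_iff] at hx
  obtain ⟨v, hv, hx⟩ := hx
  rw [Submodule.Quotient.mk_eq_zero, mem_torsion_iff]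
  -- If `w • x` is torsion, killed by `v`, then `v * w` kills `x`.
  exact ⟨v * w, W.mul_mem hv hw, by rw [mul_smul, hx]⟩

end Rules

/-! ### Duality into an injective module -/

section Duality

variable {R : Type u} [CommRing R] (W : Submonoid R) {E : Type u} [AddCommGroup E] [Module R E]

/-- Into an injective module, a linear map vanishing on the kernel of `f` factors through `f`. -/
theorem exists_comp_eq_of_ker_le_ker (hE : Module.Injective R E) {M N : Type u} [AddCommGroup M]
    [Module R M] [AddCommGroup N] [Module R N] (f : M →ₗ[R] N) (g : M →ₗ[R] E)
    (h : LinearMap.ker f ≤ LinearMap.ker g) : ∃ g' : N →ₗ[R] E, g' ∘ₗ f = g := by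
  -- Both maps descend to `M / ker f`, which embeds in `N`; injectivity of `E` extends along this
  -- embedding.
  have hinj : Function.Injective ((LinearMap.ker f).liftQ f le_rfl) :=
    LinearMap.ker_eq_bot.1 (Submodule.ker_liftQ_eq_bot' _ _ rfl)
  obtain ⟨g', hg'⟩ := hE.out _ hinj ((LinearMap.ker f).liftQ g h)
  exact ⟨g', LinearMap.ext fun x => hg' (Submodule.Quotient.mk x)⟩

/-- An injective module containing the residue field of a local ring is a cogenerator. -/
theorem exists_dual_apply_ne_zero [IsLocalRing R] (hE : Module.Injective R E)
    (ι : IsLocalRing.ResidueField R →ₗ[R] E) (hι : Function.Injective ι) {M : Type u}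
    [AddCommGroup M] [Module R M] {z : M} (hz : z ≠ 0) : ∃ g : M →ₗ[R] E, g z ≠ 0 := by
  -- The annihilator of `z ≠ 0` is a proper ideal, hence inside the maximal ideal, so `r • z ↦ ι (r
  -- mod 𝔪)` is well defined on `R z` and extends to `M`.
  obtain ⟨g, hg⟩ := exists_comp_eq_of_ker_le_ker hE (LinearMap.toSpanSingleton R M z)
    (ι ∘ₗ Algebra.linearMap R (IsLocalRing.ResidueField R)) (by
      intro r hr
      have hr' : r ∈ IsLocalRing.maximalIdeal R := by
        refine IsLocalRing.le_maximalIdeal (J := LinearMap.ker (LinearMap.toSpanSingleton R M z))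
          (fun h => hz ?_) hr
        have h1 : (1 : R) ∈ LinearMap.ker (LinearMap.toSpanSingleton R M z) := h ▸ trivial
        simpa using h1
      have : algebraMap R (IsLocalRing.ResidueField R) r = 0 :=
        (IsLocalRing.residue_eq_zero_iff r).2 hr'
      rw [LinearMap.mem_ker, LinearMap.comp_apply, Algebra.linearMap_apply, this, map_zero])
  refine ⟨g, fun h => ?_⟩
  have h1 : g z = ι 1 := by simpa using LinearMap.congr_fun hg 1
  exact one_ne_zero (hι ((h1.symm.trans h).trans (map_zero ι).symm))

/-- In a dual module, `⋂ w M^∨`, the divisible part and the trace of the localization all consist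
of the functionals vanishing on the torsion. -/
theorem iInf_range_lsmul_dual_le (N : Type u) [AddCommGroup N] [Module R N] {g : Dual R E N}
    (hg : g ∈ ⨅ w : W, LinearMap.range (LinearMap.lsmul R (Dual R E N) (w : R))) :
    torsion W N ≤ LinearMap.ker g := by
  intro z hz
  obtain ⟨w, hw, hz⟩ := (mem_torsion_iff W z).1 hz
  obtain ⟨g', rfl⟩ := (Submodule.mem_iInf _).1 hg ⟨w, hw⟩
  change w • g' z = 0
  rw [← map_smul, hz, map_zero]

/-- Since `tor_W(N)` is the kernel of `N → W⁻¹N`, injectivity of `E` extends `g` to `g'` on `W⁻¹N`,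
on which `W⁻¹R` acts. -/
theorem mem_trace_localization_dual (hE : Module.Injective R E) {N : Type u} [AddCommGroup N]
    [Module R N] {g : Dual R E N} (hg : torsion W N ≤ LinearMap.ker g) :
    g ∈ trace R (Localization W) (Dual R E N) := by
  obtain ⟨g', rfl⟩ := exists_comp_eq_of_ker_le_ker hE (LocalizedModule.mkLinearMap W N) g hg
  -- This is `a ↦ (z ↦ g' (a • (z/1)))`, whose value at `1` is `g`.
  let f : Localization W →ₗ[R] Dual R E N :=
    LinearMap.lcomp R E (LocalizedModule.mkLinearMap W N) ∘ₗ
      LinearMap.llcomp R (LocalizedModule W N) (LocalizedModule W N) E g' ∘ₗ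
      (Algebra.lsmul R R (LocalizedModule W N)).toLinearMap
  refine le_iSup (fun f : Localization W →ₗ[R] Dual R E N => LinearMap.range f) f ⟨1, ?_⟩
  ext z
  change g' ((1 : Localization W) • LocalizedModule.mkLinearMap W N z) = _
  rw [one_smul]
  rfl

theorem divisible_le_iInf_range_lsmul (M : Type u) [AddCommGroup M] [Module R M] :
    divisible W M ≤ ⨅ w : W, LinearMap.range (LinearMap.lsmul R M (w : R)) := by
  refine le_iInf fun w x hx => ?_
  obtain ⟨y, hy⟩ := isDivisibleFor_divisible W M w w.2 ⟨x, hx⟩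
  exact ⟨y, congrArg Subtype.val hy⟩

theorem iInf_range_lsmul_map_le {M N : Type u} [AddCommGroup M] [Module R M] [AddCommGroup N]
    [Module R N] (f : M →ₗ[R] N) :
    (⨅ w : W, LinearMap.range (LinearMap.lsmul R M (w : R))).map f ≤
      ⨅ w : W, LinearMap.range (LinearMap.lsmul R N (w : R)) := by
  rintro _ ⟨x, hx, rfl⟩
  refine (Submodule.mem_iInf _).2 fun w => ?_
  obtain ⟨y, rfl⟩ := (Submodule.mem_iInf _).1 hx w
  exact ⟨f y, by simp⟩

theorem iInf_range_lsmul_le_trace_of_isDualizable (hE : Module.Injective R E) {M : Type u}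
    [AddCommGroup M] [Module R M] (hM : IsDualizable R E M) :
    ⨅ w : W, LinearMap.range (LinearMap.lsmul R M (w : R)) ≤ trace R (Localization W) M := by
  obtain ⟨e⟩ := hM
  intro z hz
  -- Carry `z` to `M^∨∨`, the dual of `N = M^∨`, argue there, and come back along `e`. Any
  -- isomorphism will do, not just evaluation.
  have h := mem_trace_localization_dual W hE
    (iInf_range_lsmul_dual_le W _ (iInf_range_lsmul_map_le W e.symm.toLinearMap ⟨z, hz, rfl⟩))
  simpa using map_trace_le (Localization W) e.toLinearMap ⟨_, h, rfl⟩

theorem torsion_eq_dualQuotient [IsLocalRing R] (hE : Module.Injective R E)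
    (ι : IsLocalRing.ResidueField R →ₗ[R] E) (hι : Function.Injective ι) (M : Type u)
    [AddCommGroup M] [Module R M] :
    torsion W M = dualQuotient R E M (divisible W (Dual R E M)) := by
  ext z
  rw [mem_dualQuotient]
  constructor
  · exact fun hz g hg => iInf_range_lsmul_dual_le W M (divisible_le_iInf_range_lsmul W _ hg) hz
  · intro h
    by_contra hz
    -- A functional on `M / tor_W(M)` detecting the class of `z` pulls back to one vanishing on
    -- torsion, hence lying in `dv_W(M^∨)`, which is assumed to kill `z`.
    obtain ⟨g, hg⟩ := exists_dual_apply_ne_zero hE ι hι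
      (mt (Submodule.Quotient.mk_eq_zero (torsion W M)).1 hz)
    refine hg (h (g ∘ₗ (torsion W M).mkQ) (trace_localization_le_divisible W _
      (mem_trace_localization_dual W hE fun y hy => ?_)))
    rw [LinearMap.mem_ker, LinearMap.comp_apply, Submodule.mkQ_apply,
      (Submodule.Quotient.mk_eq_zero _).2 hy, map_zero]

end Duality

end Selectors

open Selectors in
theorem proposition9p3 {R : Type u} [CommRing R] (W : Submonoid R) :
    -- torsion freeness, divisibility and h-divisibility
    (∀ (M : Type u) [AddCommGroup M] [Module R M], IsTorsionFreeFor W M ↔ torsion W M = ⊥) ∧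
    (∀ (M : Type u) [AddCommGroup M] [Module R M], IsDivisibleFor W M ↔ divisible W M = ⊤) ∧
    (∀ (M : Type u) [AddCommGroup M] [Module R M],
      IsHDivisibleFor W M ↔ trace R (Localization W) M = ⊤) ∧
    -- the trace of the localization lies in the divisible part
    (∀ (M : Type u) [AddCommGroup M] [Module R M],
      trace R (Localization W) M ≤ divisible W M) ∧
    -- the same comparison, and the other properties of the selectors, on any class of modules
    -- closed under submodules and quotients
    (∀ (P : ModuleClass R) (hP : P.IsClosed),
      traceSelector P (Localization W) ≤ divisibleSelector W P ∧
      (∃ hs : Monotone fun w : DivIndex W => traceSelector P (R ⧸ Ideal.span {w.val}),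
        torsionSelector W P = SubmoduleSelector.dirLim _ hs) ∧
      ((divisibleSelector W P).IsIdempotent hP ∧ (divisibleSelector W P).IsFunctorial) ∧
      ((torsionSelector W P).IsIdempotent hP ∧ (torsionSelector W P).IsFunctorial ∧
        (torsionSelector W P).IsCoidempotent hP)) ∧
    -- complete Noetherian local rings
    (∀ [IsLocalRing R] [IsNoetherianRing R] [IsAdicComplete (IsLocalRing.maximalIdeal R) R]
      (E : Type u) [AddCommGroup E] [Module R E] (ι : IsLocalRing.ResidueField R →ₗ[R] E),
      IsInjectiveHull ι →
      (∀ (M : Type u) [AddCommGroup M] [Module R M], IsDualizable R E M →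
        divisible W M = trace R (Localization W) M) ∧
      (∀ (P : ModuleClass R) (hP : P.IsClosed)
        (hD : ∀ (M : Type u) [AddCommGroup M] [Module R M], P M → IsDualizable R E M),
        torsionSelector W (dualClass E P) = (divisibleSelector W P).smile E hP hD) ∧
      (∀ (M : Type u) [AddCommGroup M] [Module R M], IsDualizable R E M →
        torsion W M = dualQuotient R E M (divisible W (Dual R E M))) ∧
      (∀ (M : Type u) [AddCommGroup M] [Module R M], IsDualizable R E M →
        divisible W M = ⨅ w : W, LinearMap.range (LinearMap.lsmul R M (w : R)))) := by
  refine ⟨isTorsionFreeFor_iff W, isDivisibleFor_iff W, isHDivisibleFor_iff W,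
    trace_localization_le_divisible W, fun P hP => ⟨fun M _ _ _ =>
      trace_localization_le_divisible W M, ⟨_, torsionSelector_eq_dirLim W P⟩,
      ⟨divisibleSelector_isIdempotent W hP, fun _ _ g => map_divisible_le W g⟩,
      torsionSelector_isIdempotent W hP, fun _ _ g => map_torsion_le W g,
      torsionSelector_isCoidempotent W hP⟩, ?_⟩
  intro _ _ _ E _ _ ι hι
  have hE := hι.injective_module
  refine ⟨fun M _ _ hM => ?_, fun P hP hD => ?_,
    fun M _ _ _ => torsion_eq_dualQuotient W hE ι hι.injective M, fun M _ _ hM => ?_⟩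
  · exact le_antisymm ((divisible_le_iInf_range_lsmul W M).trans
      (iInf_range_lsmul_le_trace_of_isDualizable W hE hM)) (trace_localization_le_divisible W M)
  -- The depth bound stops at an equality of submodules, before passing to elements.
  · ext M _ _ hM : 5
    exact torsion_eq_dualQuotient W hE ι hι.injective M
  · exact le_antisymm (divisible_le_iInf_range_lsmul W M)
      ((iInf_range_lsmul_le_trace_of_isDualizable W hE hM).trans
        (trace_localization_le_divisible W M))
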